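/- A betweenness structure is a pair $\mathcal{B}=(X,\beta)$ where $X$ is a nonempty finite set and $\beta\subseteq X^3$; write $(x\ y\ z)$ for $(x,y,z)\in\beta$. It is almost-metrizable if for all $x,y,z,w\in X$: (P1) $(x\ x\ z)$; (P2) $(x\ y\ z)\Rightarrow(z\ y\ x)$; (P3) $(x\ y\ z)\wedge(y\ x\ z)\Rightarrow x=y$; (P4) $(x\ y\ z)\wedge(x\ w\ y)\Rightarrow(x\ w\ z)\wedge(w\ y\ z)$. The order of $\mathcal{B}$ is $|X|$, and its co-size is the number of its triangles, i.e. of the $3$-element subsets of $X$ that cannot be written as $\{x,y,z\}$ with $(x\ y\ z)$. Let $\tau(n,k)$ be the smallest integer $m>k$ such that there is an almost-metrizable betweenness structure of order $n$ and co-size $m$. Then $$\tau(n,n-2)=\begin{cases}2n-10 & \text{if } n\geq 9,\\ n-1 & \text{if } 4\leq n\leq 8;\end{cases}$$ in particular, for every $n\ge 4$ the minimum exists. -/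

import Mathlib

universe u

/-- A betweenness structure on a ground set `X`: a ternary relation, where `rel x y z` is read
"`y` is between `x` and `z`". The ground set is required to be nonempty and finite wherever
orders and co-sizes are considered. -/
structure BetweennessStructure (X : Type*) where
  /-- `rel x y z`: the point `y` is between `x` and `z`. -/
  rel : X → X → X → Prop

namespace BetweennessStructure

variable {X : Type*}

/-- A betweenness structure is almost-metrizable if it has the following four elementary
properties of the betweenness relation of a metric space. -/
structure IsAlmostMetrizable (B : BetweennessStructure X) : Prop where
  left_mem : ∀ x z, B.rel x x z
  symm : ∀ x y z, B.rel x y z → B.rel z y x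
  eq_of_rel : ∀ x y z, B.rel x y z → B.rel y x z → x = y
  four_relations : ∀ x y z w, B.rel x y z → B.rel x w y → B.rel x w z ∧ B.rel w y z

/-- A set of points of `B` is a collinear triple `{x, y, z}` if some ordering of it
belongs to the betweenness relation. -/
def IsCollinear (B : BetweennessStructure X) (T : Finset X) : Prop :=
  ∃ x y z, (T : Set X) = {x, y, z} ∧ B.rel x y z

/-- The triangles of `B`: the unordered triples of distinct points that are not collinear. -/
def triangles (B : BetweennessStructure X) : Set (Finset X) :=
  {T | T.card = 3 ∧ ¬ B.IsCollinear T}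

/-- The co-size of `B`: the number of its triangles. -/
noncomputable def coSize (B : BetweennessStructure X) : ℕ :=
  B.triangles.ncard

end BetweennessStructure

/-- There is an almost-metrizable betweenness structure of order `n` and co-size `m`. -/
def ExistsAlmostMetrizable (n m : ℕ) : Prop :=
  ∃ (X : Type u) (_ : Finite X) (_ : Nonempty X) (B : BetweennessStructure X),
    B.IsAlmostMetrizable ∧ Nat.card X = n ∧ B.coSize = m

/-- `IsTau n k t` says that `t` is the minimum `τ(n, k)` of the set of all `m > k` such that there
is an almost-metrizable betweenness structure of order `n` and co-size `m`
(in particular this set is nonempty). -/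
def IsTau (n k t : ℕ) : Prop :=
  IsLeast {m : ℕ | k < m ∧ ExistsAlmostMetrizable.{u} n m} t

/-! Lower bound. Suppose there are more than n - 2 but fewer than 2n - 10 triangles on n points.
Deleting points that lie in many triangles leaves five points without triangles
(`exists_five_of_few_triples`), and these form a line (`exists_isLine_five`): four triangle-free
points may form a 4-cycle, but five cannot avoid a line. Extend this line to one of maximal length k
≥ 5.

By maximality no outside point fits into the line, so each forms at least k - 3 triangles with pairs
of the line (`card_trianglePairs`). Two or more outside points then give at least (n - k)(k - 3) ≥
2n - 10 triangles. With a single outside point x, so that k = n - 1, either all triangles contain x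
and one common point of the line, hence number at most n - 2, or there are at least 2k - 8 = 2n - 10
of them. With no outside point there are no triangles. Every case is contradictory.

Sharpness. A path whose second and third vertices are doubled has exactly 2n - 10 triangles for n ≥
6. For 4 ≤ n ≤ 8 explicit metrics attain n - 1, the least value above n - 2. -/

/-! ### Adding a point to a linear order -/

/-- The ways in which a point `x` can be collinear with two points `a < b` of a linearly ordered
set of `k` points: `L a b`, `M a b`, `R a b` say that `x` lies before, between and after them. -/
structure ExtensionPattern (k : ℕ) (L M R : ℕ → ℕ → Prop) : Prop where
  not_left_right : ∀ a b, a < b → b < k → L a b → R a b → False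
  not_mid_left : ∀ a b, a < b → b < k → M a b → L a b → False
  not_mid_right : ∀ a b, a < b → b < k → M a b → R a b → False
  left_split : ∀ a b c, a < b → b < c → c < k → L a c → L a b ∧ L b c
  left_trans : ∀ a b c, a < b → b < c → c < k → L a b → L b c → L a c
  right_split : ∀ a b c, a < b → b < c → c < k → R a c → R a b ∧ R b c
  right_trans : ∀ a b c, a < b → b < c → c < k → R a b → R b c → R a c
  mid_extend_right : ∀ a b c, a < b → b < c → c < k → M a b → M a c ∧ L b c
  mid_extend_left : ∀ a b c, a < b → b < c → c < k → M b c → M a c ∧ R a b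
  mid_of_right : ∀ a b c, a < b → b < c → c < k → M a c → R a b → M b c
  mid_of_left : ∀ a b c, a < b → b < c → c < k → M a c → L b c → M a b

namespace ExtensionPattern

variable {k : ℕ} {L M R : ℕ → ℕ → Prop}

open Classical in
/-- The pairs that do not lie on one side of the new point. -/
noncomputable def mixedPairs (k : ℕ) (L R : ℕ → ℕ → Prop) : Finset (ℕ × ℕ) :=
  (Finset.range k ×ˢ Finset.range k).filter fun e => e.1 < e.2 ∧ ¬ L e.1 e.2 ∧ ¬ R e.1 e.2

open Classical in
/-- The pairs that form a triangle with the new point. -/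
noncomputable def trianglePairs (k : ℕ) (L M R : ℕ → ℕ → Prop) : Finset (ℕ × ℕ) :=
  (mixedPairs k L R).filter fun e => ¬ M e.1 e.2

/-- The new point fits into the linear order just before the position `q`. -/
def Insertable (k : ℕ) (L M R : ℕ → ℕ → Prop) : Prop :=
  ∃ q ≤ k, ∀ a b, a < b → b < k →
    (b < q → R a b) ∧ (a < q → q ≤ b → M a b) ∧ (q ≤ a → L a b)

theorem mem_mixedPairs {a b : ℕ} :
    (a, b) ∈ mixedPairs k L R ↔ b < k ∧ a < b ∧ ¬ L a b ∧ ¬ R a b := by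
  simp only [mixedPairs, Finset.mem_filter, Finset.mem_product, Finset.mem_range]
  constructor
  · rintro ⟨⟨_, h⟩, h'⟩; exact ⟨h, h'⟩
  · rintro ⟨h, h'⟩; exact ⟨⟨by omega, h⟩, h'⟩

theorem mem_trianglePairs {a b : ℕ} :
    (a, b) ∈ trianglePairs k L M R ↔ b < k ∧ a < b ∧ ¬ L a b ∧ ¬ R a b ∧ ¬ M a b := by
  simp only [trianglePairs, Finset.mem_filter, mem_mixedPairs]
  tauto

theorem left_of_le (h : ExtensionPattern k L M R) {a b c d : ℕ} (hac : a ≤ c) (hcd : c < d)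
    (hdb : d ≤ b) (hb : b < k) (hL : L a b) : L c d := by
  have h1 : L c b := by
    rcases hac.eq_or_lt with rfl | hac
    · exact hL
    · exact (h.left_split a c b hac (by omega) hb hL).2
  rcases hdb.eq_or_lt with rfl | hdb
  · exact h1
  · exact (h.left_split c d b hcd hdb hb h1).1

theorem right_of_le (h : ExtensionPattern k L M R) {a b c d : ℕ} (hac : a ≤ c) (hcd : c < d)
    (hdb : d ≤ b) (hb : b < k) (hR : R a b) : R c d := by
  have h1 : R c b := by
    rcases hac.eq_or_lt with rfl | hac
    · exact hR
    · exact (h.right_split a c b hac (by omega) hb hR).2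
  rcases hdb.eq_or_lt with rfl | hdb
  · exact h1
  · exact (h.right_split c d b hcd hdb hb h1).1

/-- If all triples of consecutive points between `a` and `b` lie on one side of the new point,
then so do `a` and `b`. -/
theorem one_sided (h : ExtensionPattern k L M R) {a b : ℕ} (hab : a + 2 ≤ b) (hb : b < k)
    (hc : ∀ p, a < p → p < b → L (p - 1) (p + 1) ∨ R (p - 1) (p + 1)) : L a b ∨ R a b := by
  induction b, hab using Nat.le_induction with
  | base => simpa using hc (a + 1) (by omega) (by omega)
  | succ b hab ih =>
    have h1 := ih (by omega) fun p h1 h2 => hc p h1 (by omega)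
    have h2 := hc b (by omega) (by omega)
    rcases h1 with h1 | h1 <;> rcases h2 with h2 | h2
    · left
      exact h.left_trans a b (b + 1) (by omega) (by omega) hb h1
        (h.left_of_le (by omega) (by omega) le_rfl hb h2)
    · exact (h.not_left_right (b - 1) b (by omega) (by omega)
        (h.left_of_le (by omega) (by omega) le_rfl (by omega) h1)
        (h.right_of_le le_rfl (by omega) (by omega) hb h2)).elim
    · exact (h.not_left_right (b - 1) b (by omega) (by omega)
        (h.left_of_le le_rfl (by omega) (by omega) hb h2)
        (h.right_of_le (by omega) (by omega) le_rfl (by omega) h1)).elim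
    · right
      exact h.right_trans a b (b + 1) (by omega) (by omega) hb h1
        (h.right_of_le (by omega) (by omega) le_rfl hb h2)

/-- A break between the neighbours of `p` spreads to all pairs around `p`. -/
theorem rectangle_subset (h : ExtensionPattern k L M R) {p : ℕ} (hp : 0 < p)
    (hL : ¬ L (p - 1) (p + 1)) (hR : ¬ R (p - 1) (p + 1)) :
    Finset.range p ×ˢ Finset.Ico (p + 1) k ⊆ mixedPairs k L R := by
  rintro ⟨a, b⟩ hab
  simp only [Finset.mem_product, Finset.mem_range, Finset.mem_Ico] at hab
  refine mem_mixedPairs.2 ⟨by omega, by omega, fun h' => hL ?_, fun h' => hR ?_⟩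
  · exact h.left_of_le (by omega) (by omega) (by omega) (by omega) h'
  · exact h.right_of_le (by omega) (by omega) (by omega) (by omega) h'

theorem card_rectangle (p q k : ℕ) :
    (Finset.range p ×ˢ Finset.Ico q k).card = p * (k - q) := by
  simp

/-- Call p a break if its two neighbours are not on one side of the new point. Without breaks the
whole line would be one-sided. A break at p makes all p(k - 1 - p) pairs around it mixed: at least
2k - 6 if p is not next to an end. A lone break next to an end gives k - 2 mixed pairs, all through
that end. -/
theorem card_mixedPairs (h : ExtensionPattern k L M R) (hk : 4 ≤ k)
    (hL : ¬ L 0 (k - 1)) (hR : ¬ R 0 (k - 1)) :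
    2 * k ≤ (mixedPairs k L R).card + 6 ∨ k ≤ (mixedPairs k L R).card + 2 ∧
      ∃ y < k, ∀ e ∈ mixedPairs k L R, e.1 = y ∨ e.2 = y := by
  classical
  by_cases hmid : ∃ p, 2 ≤ p ∧ p + 3 ≤ k ∧ ¬ L (p - 1) (p + 1) ∧ ¬ R (p - 1) (p + 1)
  · left
    obtain ⟨p, hp, hpk, h1, h2⟩ := hmid
    have h3 := Finset.card_le_card (h.rectangle_subset (by omega) h1 h2)
    rw [card_rectangle] at h3
    obtain ⟨r, rfl⟩ : ∃ r, k = p + 1 + (2 + r) := ⟨k - p - 3, by omega⟩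
    obtain ⟨s, rfl⟩ : ∃ s, p = 2 + s := ⟨p - 2, by omega⟩
    have : 2 + s + 1 + (2 + r) - (2 + s + 1) = 2 + r := by omega
    rw [this] at h3
    have : (2 + s) * (2 + r) = 4 + 2 * s + 2 * r + s * r := by ring
    have : 0 ≤ s * r := Nat.zero_le _
    omega
  have hmid' : ∀ p, 2 ≤ p → p + 3 ≤ k → L (p - 1) (p + 1) ∨ R (p - 1) (p + 1) := by
    intro p h1 h2
    by_contra h3
    exact hmid ⟨p, h1, h2, by tauto, by tauto⟩
  have rect1 : ¬ (L 0 2 ∨ R 0 2) → Finset.range 1 ×ˢ Finset.Ico 2 k ⊆ mixedPairs k L R :=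
    fun h' => h.rectangle_subset (p := 1) (by omega) (by simp; tauto) (by simp; tauto)
  have rect2 : ¬ (L (k - 3) (k - 1) ∨ R (k - 3) (k - 1)) →
      Finset.range (k - 2) ×ˢ Finset.Ico (k - 1) k ⊆ mixedPairs k L R := by
    intro h'
    have e1 : k - 2 - 1 = k - 3 := by omega
    have e2 : k - 2 + 1 = k - 1 := by omega
    have := h.rectangle_subset (p := k - 2) (by omega) (by rw [e1, e2]; tauto)
      (by rw [e1, e2]; tauto)
    rwa [e2] at this
  by_cases hs : L 0 2 ∨ R 0 2 <;> by_cases ht : L (k - 3) (k - 1) ∨ R (k - 3) (k - 1)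
  · exfalso
    have := h.one_sided (a := 0) (b := k - 1) (by omega) (by omega) fun p h1 h2 => by
      rcases Nat.lt_or_ge p 2 with h3 | h3
      · obtain rfl : p = 1 := by omega
        exact hs
      · rcases Nat.lt_or_ge k (p + 3) with h4 | h4
        · obtain rfl : p = k - 2 := by omega
          rwa [show k - 2 - 1 = k - 3 by omega, show k - 2 + 1 = k - 1 by omega]
        · exact hmid' p h3 h4
    tauto
  -- The only break is at k - 2: the points 0, …, k - 2 are one-sided, so a mixed pair must use k -
  -- 1.
  · right
    have h3 := Finset.card_le_card (rect2 ht)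
    rw [card_rectangle, show k - (k - 1) = 1 by omega] at h3
    refine ⟨by omega, k - 1, by omega, ?_⟩
    rintro ⟨a, b⟩ hab
    obtain ⟨h1, h2, h4, h5⟩ := mem_mixedPairs.1 hab
    right
    by_contra hb
    have := h.one_sided (a := 0) (b := k - 2) (by omega) (by omega) fun p h1 h2 => by
      rcases Nat.lt_or_ge p 2 with h3 | h3
      · obtain rfl : p = 1 := by omega
        exact hs
      · exact hmid' p h3 (by omega)
    rcases this with h6 | h6
    · exact h4 (h.left_of_le (by omega) h2 (by simp at hb; omega) (by omega) h6)
    · exact h5 (h.right_of_le (by omega) h2 (by simp at hb; omega) (by omega) h6)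
  · right
    have h3 := Finset.card_le_card (rect1 hs)
    rw [card_rectangle] at h3
    refine ⟨by omega, 0, by omega, ?_⟩
    rintro ⟨a, b⟩ hab
    obtain ⟨h1, h2, h4, h5⟩ := mem_mixedPairs.1 hab
    left
    by_contra ha
    have := h.one_sided (a := 1) (b := k - 1) (by omega) (by omega) fun p h1 h2 => by
      rcases Nat.lt_or_ge k (p + 3) with h4 | h4
      · obtain rfl : p = k - 2 := by omega
        rwa [show k - 2 - 1 = k - 3 by omega, show k - 2 + 1 = k - 1 by omega]
      · exact hmid' p h1 h4
    rcases this with h6 | h6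
    · exact h4 (h.left_of_le (by simp at ha; omega) h2 (by omega) (by omega) h6)
    · exact h5 (h.right_of_le (by simp at ha; omega) h2 (by omega) (by omega) h6)
  · left
    have h3 := Finset.card_le_card (Finset.union_subset (rect1 hs) (rect2 ht))
    have h4 := Finset.card_union_add_card_inter (Finset.range 1 ×ˢ Finset.Ico 2 k)
      (Finset.range (k - 2) ×ˢ Finset.Ico (k - 1) k)
    -- The two rectangles, of size k - 2 each, share only the pair of ends, leaving 2k - 5 mixed
    -- pairs.
    have h5 : ((Finset.range 1 ×ˢ Finset.Ico 2 k) ∩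
        (Finset.range (k - 2) ×ˢ Finset.Ico (k - 1) k)).card ≤ 1 := by
      refine (Finset.card_le_card (t := {(0, k - 1)}) ?_).trans (by simp)
      rintro ⟨a, b⟩ hab
      simp only [Finset.mem_inter, Finset.mem_product, Finset.mem_range, Finset.mem_Ico] at hab
      simp only [Finset.mem_singleton, Prod.mk.injEq]
      omega
    rw [card_rectangle, card_rectangle, show k - (k - 1) = 1 by omega] at h4
    omega

theorem card_mixedPairs_le {S : Finset (ℕ × ℕ)}
    (hS : ∀ a b, a < b → b < k → M a b → (a, b) ∈ S) :
    (mixedPairs k L R).card ≤ (trianglePairs k L M R).card + S.card := by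
  classical
  refine (Finset.card_le_card (t := trianglePairs k L M R ∪ S) ?_).trans
    (Finset.card_union_le _ _)
  rintro ⟨a, b⟩ hab
  rw [Finset.mem_union, mem_trianglePairs]
  rw [mem_mixedPairs] at hab
  by_cases hM : M a b
  · exact Or.inr (hS a b hab.2.1 hab.1 hM)
  · exact Or.inl (by tauto)

theorem trianglePairs_subset : trianglePairs k L M R ⊆ mixedPairs k L R := by
  classical exact Finset.filter_subset _ _

/-- The pairs between which the new point lies, if not empty, form a quadrant. -/
theorem exists_mid_corner (h : ExtensionPattern k L M R)
    (hM : ∃ a b, a < b ∧ b < k ∧ M a b) :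
    ∃ i j, i < j ∧ j < k ∧ M i j ∧ (∀ l, i < l → l < j → ¬ R i l ∧ ¬ L l j) ∧
      ∀ a b, a < b → b < k → M a b → a ≤ i ∧ j ≤ b := by
  classical
  -- The corner is a pair around the new point with the least index difference; any violation of the
  -- claims produces a closer such pair or a contradiction.
  have hex : ∃ d a, a + d < k ∧ 0 < d ∧ M a (a + d) := by
    obtain ⟨a, b, hab, hb, hm⟩ := hM
    exact ⟨b - a, a, by omega, by omega, by rwa [Nat.add_sub_cancel' hab.le]⟩
  have hmin := fun m (hm : m < Nat.find hex) => Nat.find_min hex hm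
  obtain ⟨i, hi, hd, hm⟩ := Nat.find_spec hex
  set d := Nat.find hex
  have hshort : ∀ a b, a < b → b < k → b < a + d → ¬ M a b := by
    intro a b hab hb hlt hmab
    exact hmin (b - a) (by omega)
      ⟨a, by omega, by omega, by rwa [Nat.add_sub_cancel' hab.le]⟩
  refine ⟨i, i + d, by omega, hi, hm, fun l h1 h2 => ⟨fun hr => ?_, fun hl => ?_⟩, ?_⟩
  · exact hshort l (i + d) h2 hi (by omega) (h.mid_of_right i l _ h1 h2 hi hm hr)
  · exact hshort i l h1 (by omega) (by omega) (h.mid_of_left i l _ h1 h2 hi hm hl)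
  · intro a b hab hb hmab
    constructor
    · by_contra hia
      have hr := (h.mid_extend_left i a b (by omega) hab hb hmab).2
      rcases lt_trichotomy a (i + d) with h1 | h1 | h1
      · exact hshort a (i + d) h1 hi (by omega)
          (h.mid_of_right i a _ (by omega) h1 hi hm hr)
      · rw [h1] at hr
        exact h.not_mid_right _ _ (by omega) hi hm hr
      · exact h.not_mid_right _ _ (by omega) hi hm
          (h.right_of_le le_rfl (by omega) h1.le (by omega) hr)
    · by_contra hjb
      have hl := (h.mid_extend_right a b (i + d) hab (by omega) hi hmab).2
      rcases lt_trichotomy i b with h1 | h1 | h1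
      · exact hshort i b h1 hb (by omega)
          (h.mid_of_left i b _ h1 (by omega) hi hm hl)
      · rw [← h1] at hl
        exact h.not_mid_left _ _ (by omega) hi hm hl
      · exact h.not_mid_left _ _ (by omega) hi hm
          (h.left_of_le h1.le (by omega) le_rfl hi hl)

/-- The main estimate: a point that does not fit into a linear order of `k` points forms at least
`k - 3` triangles with it; they share a second point or there are at least `2 k - 8` of them. -/
theorem card_trianglePairs (h : ExtensionPattern k L M R) (hk : 4 ≤ k)
    (hins : ¬ Insertable k L M R) :
    k ≤ (trianglePairs k L M R).card + 3 ∧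
      ((∃ y < k, ∀ e ∈ trianglePairs k L M R, e.1 = y ∨ e.2 = y) ∨
        2 * k ≤ (trianglePairs k L M R).card + 8) := by
  classical
  have hL : ¬ L 0 (k - 1) := fun hL => hins ⟨0, by omega, fun a b hab hb =>
    ⟨by omega, by omega, fun _ => h.left_of_le (by omega) hab (by omega) (by omega) hL⟩⟩
  have hR : ¬ R 0 (k - 1) := fun hR => hins ⟨k, by omega, fun a b hab hb =>
    ⟨fun _ => h.right_of_le (by omega) hab (by omega) (by omega) hR, by omega, by omega⟩⟩
  have hN := h.card_mixedPairs hk hL hR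
  -- If the new point lies between at most one pair, all mixed pairs but one are triangles, and the
  -- bounds 2k - 6 and k - 2 drop only to 2k - 7 and k - 3.
  have few : ∀ S : Finset (ℕ × ℕ), S.card ≤ 1 →
      (∀ a b, a < b → b < k → M a b → (a, b) ∈ S) → _ := fun S hc hS => by
    have h1 := card_mixedPairs_le (L := L) (R := R) hS
    show k ≤ (trianglePairs k L M R).card + 3 ∧
      ((∃ y < k, ∀ e ∈ trianglePairs k L M R, e.1 = y ∨ e.2 = y) ∨
        2 * k ≤ (trianglePairs k L M R).card + 8)
    rcases hN with hN | ⟨hN, y, hy, hN'⟩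
    · exact ⟨by omega, Or.inr (by omega)⟩
    · exact ⟨by omega, Or.inl ⟨y, hy, fun e he => hN' e (trianglePairs_subset he)⟩⟩
  by_cases hM : ∃ a b, a < b ∧ b < k ∧ M a b
  swap
  · exact few ∅ (by simp) fun a b hab hb hm => (hM ⟨a, b, hab, hb, hm⟩).elim
  obtain ⟨i, j, hij, hj, hm, hmin, hquad⟩ := h.exists_mid_corner hM
  have hRi : ∀ a b, a < b → b ≤ i → R a b := by
    intro a b hab hb
    exact h.right_of_le le_rfl hab hb (by omega)
      (h.mid_extend_left a i j (by omega) hij hj hm).2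
  have hLj : ∀ a b, a < b → j ≤ a → b < k → L a b := by
    intro a b hab hja hb
    exact h.left_of_le hja hab le_rfl hb
      (h.mid_extend_right i j b hij (by omega) hb hm).2
  have hMij : ∀ a b, a ≤ i → j ≤ b → b < k → M a b := by
    intro a b ha hjb hb
    have h1 : M i b := by
      rcases hjb.eq_or_lt with rfl | hjb
      · exact hm
      · exact (h.mid_extend_right i j b hij hjb hb hm).1
    rcases ha.eq_or_lt with rfl | ha
    · exact h1
    · exact (h.mid_extend_left a i b ha (by omega) hb h1).1
  -- If i and j were adjacent, the new point would fit between them.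
  have hij2 : i + 2 ≤ j := by
    by_contra hlt
    exact hins ⟨i + 1, by omega, fun a b hab hb => ⟨fun h1 => hRi a b hab (by omega),
      fun h1 h2 => hMij a b (by omega) (by omega) hb,
      fun h1 => hLj a b hab (by omega) hb⟩⟩
  -- For a < i < b < j: `L a b` clashes with `R a i`, `R a b` would restrict to `R i b`, and `M a b`
  -- falls outside the quadrant. `hS2` is the mirror image.
  have hS1 : Finset.range i ×ˢ Finset.Ico (i + 1) j ⊆ trianglePairs k L M R := by
    rintro ⟨a, b⟩ hab
    simp only [Finset.mem_product, Finset.mem_range, Finset.mem_Ico] at hab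
    refine mem_trianglePairs.2 ⟨by omega, by omega, fun hl => ?_, fun hr => ?_, fun hm' => ?_⟩
    · exact h.not_left_right a i (by omega) (by omega)
        (h.left_of_le le_rfl (by omega) (by omega) (by omega) hl) (hRi a i (by omega) le_rfl)
    · exact (hmin b (by omega) (by omega)).1
        (h.right_of_le (by omega) (by omega) le_rfl (by omega) hr)
    · have := hquad a b (by omega) (by omega) hm'
      omega
  have hS2 : Finset.Ico (i + 1) j ×ˢ Finset.Ico (j + 1) k ⊆ trianglePairs k L M R := by
    rintro ⟨a, b⟩ hab
    simp only [Finset.mem_product, Finset.mem_Ico] at hab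
    refine mem_trianglePairs.2 ⟨by omega, by omega, fun hl => ?_, fun hr => ?_, fun hm' => ?_⟩
    · exact (hmin a (by omega) (by omega)).2
        (h.left_of_le le_rfl (by omega) (by omega) (by omega) hl)
    · exact h.not_left_right j b (by omega) (by omega)
        (hLj j b (by omega) le_rfl (by omega))
        (h.right_of_le (by omega) (by omega) le_rfl (by omega) hr)
    · have := hquad a b (by omega) (by omega) hm'
      omega
  have hcard : (j - (i + 1)) * (i + (k - (j + 1))) ≤ (trianglePairs k L M R).card := by
    have h1 := Finset.card_le_card (Finset.union_subset hS1 hS2)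
    rw [Finset.card_union_of_disjoint] at h1
    · simp only [Finset.card_product, Finset.card_range, Nat.card_Ico] at h1
      calc _ = i * (j - (i + 1)) + (j - (i + 1)) * (k - (j + 1)) := by ring
        _ ≤ _ := h1
    · rw [Finset.disjoint_left]
      rintro ⟨a, b⟩ h2 h3
      simp only [Finset.mem_product, Finset.mem_range, Finset.mem_Ico] at h2 h3
      omega
  -- The corner has r + 1 points strictly inside, i points before and s points after it, so there
  -- are at least (r + 1)(i + s) triangles, with k = i + r + s + 3.
  obtain ⟨r, rfl⟩ : ∃ r, j = i + 2 + r := ⟨j - i - 2, by omega⟩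
  obtain ⟨s, rfl⟩ : ∃ s, k = i + 2 + r + 1 + s := ⟨k - (i + 2 + r) - 1, by omega⟩
  rw [show i + 2 + r - (i + 1) = r + 1 by omega,
    show i + (i + 2 + r + 1 + s - (i + 2 + r + 1)) = i + s by omega] at hcard
  -- With one inner point i + 1, pairs avoiding it are of type `R`, `M` or `L`, so every triangle
  -- uses it.
  by_cases hr : r = 0
  · subst hr
    refine ⟨by omega, Or.inl ⟨i + 1, by omega, ?_⟩⟩
    rintro ⟨a, b⟩ hab
    obtain ⟨h1, h2, h3, h4, h5⟩ := mem_trianglePairs.1 hab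
    by_contra hne
    simp only [not_or] at hne
    rcases Nat.lt_or_ge i b with hb | hb
    · rcases Nat.lt_or_ge i a with ha | ha
      · exact h3 (hLj a b h2 (by omega) (by omega))
      · exact h5 (hMij a b ha (by omega) (by omega))
    · exact h4 (hRi a b h2 hb)
  by_cases h0 : i + s = 0
  · refine few {(0, r + 2)} (by simp) fun a b hab hb hm' => ?_
    have := hquad a b hab hb hm'
    simp only [Finset.mem_singleton, Prod.mk.injEq]
    omega
  obtain ⟨r, rfl⟩ := Nat.exists_eq_succ_of_ne_zero hr
  obtain ⟨t, ht⟩ := Nat.exists_eq_succ_of_ne_zero h0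
  rw [ht, show (r.succ + 1) * t.succ = 2 + r + 2 * t + r * t by
    simp only [Nat.succ_eq_add_one]; ring] at hcard
  have hrt := Nat.zero_le (r * t)
  refine ⟨by omega, ?_⟩
  rcases Nat.eq_zero_or_pos t with rfl | htpos
  swap
  · right
    have : r ≤ r * t := Nat.le_mul_of_pos_right r htpos
    omega
  -- Here i + s = 1, so the quadrant has exactly two pairs; removing them from 2k - 6 mixed pairs
  -- leaves 2k - 8.
  have h1 := card_mixedPairs_le (L := L) (R := R) (k := i + 2 + (r + 1) + 1 + s) (M := M)
    (S := Finset.range (i + 1) ×ˢ Finset.Ico (i + 2 + (r + 1)) (i + 2 + (r + 1) + 1 + s))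
    fun a b hab hb hm' => by
      have := hquad a b hab hb hm'
      simp only [Finset.mem_product, Finset.mem_range, Finset.mem_Ico]
      omega
  rw [card_rectangle, show i + 2 + (r + 1) + 1 + s - (i + 2 + (r + 1)) = s + 1 by omega] at h1
  have h2 : (i + 1) * (s + 1) = 2 := by
    rcases Nat.eq_zero_or_pos i with rfl | hi
    · obtain rfl : s = 1 := by omega
      rfl
    · obtain rfl : i = 1 := by omega
      obtain rfl : s = 0 := by omega
      rfl
  rcases hN with hN | ⟨hN, y, hy, hN'⟩
  · exact Or.inr (by simp only [Nat.succ_eq_add_one] at *; omega)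
  · exact Or.inl ⟨y, hy, fun e he => hN' e (trianglePairs_subset he)⟩

end ExtensionPattern

/-! ### Averaging over triples of points -/

namespace Finset

variable {X : Type*} [DecidableEq X]

/-- Some point of `S` lies in at least the average number of the triples inside `S`. -/
theorem exists_erase_card_triples (F : Finset (Finset X)) (hF : ∀ T ∈ F, T.card = 3)
    (S : Finset X) (hS : S.Nonempty) :
    ∃ v ∈ S, ∃ d, 3 * (F.filter (· ⊆ S)).card ≤ d * S.card ∧
      (F.filter (· ⊆ S.erase v)).card + d = (F.filter (· ⊆ S)).card := by
  -- Double counting: each triple inside `S` is counted once at each of its three points.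
  have hsum : ∑ v ∈ S, ((F.filter (· ⊆ S)).filter (v ∈ ·)).card
      = 3 * (F.filter (· ⊆ S)).card := by
    have h1 := Finset.sum_card_bipartiteAbove_eq_sum_card_bipartiteBelow
      (s := S) (t := F.filter (· ⊆ S)) (fun v T => v ∈ T)
    simp only [Finset.bipartiteAbove, Finset.bipartiteBelow] at h1
    rw [h1, Finset.sum_congr rfl (g := fun _ => 3), Finset.sum_const, smul_eq_mul, mul_comm]
    intro T hT
    rw [Finset.mem_filter] at hT
    rw [Finset.filter_mem_eq_inter, Finset.inter_eq_right.2 hT.2, hF T hT.1]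
  obtain ⟨v, hv, hmax⟩ := Finset.exists_max_image S
    (fun v => ((F.filter (· ⊆ S)).filter (v ∈ ·)).card) hS
  refine ⟨v, hv, ((F.filter (· ⊆ S)).filter (v ∈ ·)).card, ?_, ?_⟩
  · rw [← hsum, mul_comm, ← smul_eq_mul]
    exact Finset.sum_le_card_nsmul _ _ _ hmax
  · have h1 := Finset.card_filter_add_card_filter_not (s := F.filter (· ⊆ S)) (v ∈ ·)
    rw [← h1, add_comm]
    congr 2
    ext T
    simp only [Finset.mem_filter, Finset.subset_erase]
    tauto

/-- Fewer than `2 n - 10` triples on `n ≥ 6` points miss some set of five points. -/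
theorem exists_five_of_few_triples (F : Finset (Finset X)) (hF : ∀ T ∈ F, T.card = 3) (n : ℕ)
    (hn : 6 ≤ n) (S : Finset X) (hS : S.card = n) (hm : (F.filter (· ⊆ S)).card + 11 ≤ 2 * n) :
    ∃ S' : Finset X, S'.card = 5 ∧ ∀ T ∈ F, ¬ T ⊆ S' := by
  induction n, hn using Nat.le_induction generalizing S with
  | base =>
    obtain ⟨v, hv, d, h1, h2⟩ := exists_erase_card_triples F hF S
      (Finset.card_pos.1 (by omega))
    refine ⟨S.erase v, by rw [Finset.card_erase_of_mem hv]; omega, fun T hT hsub => ?_⟩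
    have : 0 < (F.filter (· ⊆ S.erase v)).card :=
      Finset.card_pos.2 ⟨T, Finset.mem_filter.2 ⟨hT, hsub⟩⟩
    rw [hS] at h1
    omega
  | succ n hn ih =>
    obtain ⟨v, hv, d, h1, h2⟩ := exists_erase_card_triples F hF S
      (Finset.card_pos.1 (by omega))
    refine ih (S.erase v) (by rw [Finset.card_erase_of_mem hv]; omega) ?_
    by_contra hlt
    rw [hS] at h1
    -- Losing two triples would preserve the bound. If d ≤ 1, then at least 2n - 10 + d triples are
    -- present, while the average allows only d(n + 1)/3, impossible for n ≥ 6.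
    have hd : d ≤ 1 := by omega
    interval_cases d <;> omega

end Finset

/-! ### Lines, and five points without triangles -/

namespace BetweennessStructure

variable {X : Type*} {B : BetweennessStructure X}

/-- The points `p 0, …, p (k - 1)` are distinct and ordered linearly by the betweenness. -/
structure IsLine (B : BetweennessStructure X) (k : ℕ) (p : ℕ → X) : Prop where
  ne : ∀ a b, a < b → b < k → p a ≠ p b
  rel : ∀ a b c, a < b → b < c → c < k → B.rel (p a) (p b) (p c)

theorem IsLine.injOn {k : ℕ} {p : ℕ → X} (hp : B.IsLine k p) {a b : ℕ} (ha : a < k) (hb : b < k)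
    (hab : p a = p b) : a = b := by
  rcases lt_trichotomy a b with h | h | h
  · exact (hp.ne a b h hb hab).elim
  · exact h
  · exact (hp.ne b a h ha hab.symm).elim

/-- Exclusivity of the three positions is (P3), together with distinctness of the points; every
other axiom is one application of (P4), up to reversal by (P2). -/
theorem IsAlmostMetrizable.extensionPattern (h : B.IsAlmostMetrizable) {k : ℕ} {p : ℕ → X}
    (hp : B.IsLine k p) {x : X} (hx : ∀ a < k, p a ≠ x) :
    ExtensionPattern k (fun a b => B.rel x (p a) (p b)) (fun a b => B.rel (p a) x (p b))
      (fun a b => B.rel (p a) (p b) x) where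
  not_left_right a b hab hb hl hr :=
    hp.ne a b hab hb (h.eq_of_rel _ _ _ hr (h.symm _ _ _ hl))
  not_mid_left a b hab hb hm hl := hx a (by omega) (h.eq_of_rel _ _ _ hm hl)
  not_mid_right a b _ hb hm hr :=
    hx b hb (h.eq_of_rel _ _ _ (h.symm _ _ _ hm) (h.symm _ _ _ hr))
  left_split a b c hab hbc hc hl := by
    have := h.four_relations _ _ _ _ (h.symm _ _ _ hl) (h.symm _ _ _ (hp.rel a b c hab hbc hc))
    exact ⟨h.symm _ _ _ this.2, h.symm _ _ _ this.1⟩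
  left_trans a b c _ _ _ h1 h2 := (h.four_relations _ _ _ _ h2 h1).1
  right_split a b c hab hbc hc hr := h.four_relations _ _ _ _ hr (hp.rel a b c hab hbc hc)
  right_trans a b c _ _ _ h1 h2 :=
    h.symm _ _ _ (h.four_relations _ _ _ _ (h.symm _ _ _ h1) (h.symm _ _ _ h2)).1
  mid_extend_right a b c hab hbc hc hm := h.four_relations _ _ _ _ (hp.rel a b c hab hbc hc) hm
  mid_extend_left a b c hab hbc hc hm := by
    have := h.four_relations _ _ _ _ (h.symm _ _ _ (hp.rel a b c hab hbc hc)) (h.symm _ _ _ hm)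
    exact ⟨h.symm _ _ _ this.1, h.symm _ _ _ this.2⟩
  mid_of_right a b c _ _ _ hm hr := (h.four_relations _ _ _ _ hm hr).2
  mid_of_left a b c _ _ _ hm hl := h.symm _ _ _
    (h.four_relations _ _ _ _ (h.symm _ _ _ hm) (h.symm _ _ _ hl)).2

/-- The pairs of points of a line that form a triangle with `x`. -/
noncomputable abbrev linePairs (B : BetweennessStructure X) (k : ℕ) (p : ℕ → X) (x : X) :
    Finset (ℕ × ℕ) :=
  ExtensionPattern.trianglePairs k (fun a b => B.rel x (p a) (p b))
    (fun a b => B.rel (p a) x (p b)) (fun a b => B.rel (p a) (p b) x)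

theorem IsLine.exists_insert {k : ℕ} {p : ℕ → X} (hp : B.IsLine k p) {x : X}
    (hx : ∀ a < k, p a ≠ x)
    (hins : ExtensionPattern.Insertable k (fun a b => B.rel x (p a) (p b))
      (fun a b => B.rel (p a) x (p b)) (fun a b => B.rel (p a) (p b) x)) :
    ∃ p', B.IsLine (k + 1) p' ∧ ∀ a < k + 1, p' a = x ∨ ∃ b < k, p' a = p b := by
  obtain ⟨q, hq, H⟩ := hins
  have hlt : ∀ a, a < q → (if a < q then p a else if a = q then x else p (a - 1)) = p a :=
    fun a ha => if_pos ha
  have hgt : ∀ a, q < a → (if a < q then p a else if a = q then x else p (a - 1)) = p (a - 1) :=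
    fun a ha => by rw [if_neg (by omega), if_neg (by omega)]
  have heq : (if q < q then p q else if q = q then x else p (q - 1)) = x := by simp
  refine ⟨fun a => if a < q then p a else if a = q then x else p (a - 1), ⟨?_, ?_⟩, ?_⟩
  · intro a b hab hb
    rcases lt_trichotomy a q with h1 | h1 | h1
    · rw [hlt a h1]
      rcases lt_trichotomy b q with h2 | h2 | h2
      · rw [hlt b h2]; exact hp.ne _ _ hab (by omega)
      · subst h2; rw [heq]; exact hx a (by omega)
      · rw [hgt b h2]; exact hp.ne _ _ (by omega) (by omega)
    · subst h1
      rw [heq, hgt b hab]; exact (hx _ (by omega)).symm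
    · rw [hgt a h1, hgt b (by omega)]; exact hp.ne _ _ (by omega) (by omega)
  · intro a b c hab hbc hc
    rcases lt_trichotomy a q with h1 | h1 | h1
    · rw [hlt a h1]
      rcases lt_trichotomy b q with h2 | h2 | h2
      · rw [hlt b h2]
        rcases lt_trichotomy c q with h3 | h3 | h3
        · rw [hlt c h3]; exact hp.rel _ _ _ hab hbc (by omega)
        · subst h3; rw [heq]; exact (H a b hab (by omega)).1 hbc
        · rw [hgt c h3]; exact hp.rel _ _ _ hab (by omega) (by omega)
      · subst h2
        rw [heq, hgt c hbc]
        exact (H a (c - 1) (by omega) (by omega)).2.1 h1 (by omega)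
      · rw [hgt b h2, hgt c (by omega)]
        exact hp.rel _ _ _ (by omega) (by omega) (by omega)
    · subst h1
      rw [heq, hgt b hab, hgt c (by omega)]
      exact (H (b - 1) (c - 1) (by omega) (by omega)).2.2 (by omega)
    · rw [hgt a h1, hgt b (by omega), hgt c (by omega)]
      exact hp.rel _ _ _ (by omega) (by omega) (by omega)
  · intro a ha
    dsimp only
    rcases lt_trichotomy a q with h1 | h1 | h1
    · rw [hlt a h1]; exact Or.inr ⟨a, by omega, rfl⟩
    · subst h1; rw [heq]; exact Or.inl rfl
    · rw [hgt a h1]; exact Or.inr ⟨a - 1, by omega, rfl⟩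

theorem IsAlmostMetrizable.isCollinear_iff [DecidableEq X] (h : B.IsAlmostMetrizable) {x y z : X}
    (hxy : x ≠ y) (hxz : x ≠ z) (hyz : y ≠ z) :
    B.IsCollinear {x, y, z} ↔ B.rel x y z ∨ B.rel y x z ∨ B.rel y z x := by
  constructor
  · rintro ⟨u, v, w, huvw, hrel⟩
    have hs := h.symm _ _ _ hrel
    have e : ∀ t, (t = x ∨ t = y ∨ t = z) ↔ (t = u ∨ t = v ∨ t = w) := fun t => by
      have := Set.ext_iff.1 huvw t
      simpa using this
    have hx := (e x).1 (by simp)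
    have hy := (e y).1 (by simp)
    have hz := (e z).1 (by simp)
    rcases hx with rfl | rfl | rfl <;> rcases hy with rfl | rfl | rfl <;>
      rcases hz with rfl | rfl | rfl <;> simp_all
  · rintro (h | h | h)
    · exact ⟨x, y, z, by simp, h⟩
    · exact ⟨y, x, z, by simp [Set.insert_comm], h⟩
    · exact ⟨y, z, x, by ext t; simp; tauto, h⟩

theorem IsAlmostMetrizable.mem_triangles_iff [DecidableEq X] (h : B.IsAlmostMetrizable) {x y z : X}
    (hxy : x ≠ y) (hxz : x ≠ z) (hyz : y ≠ z) :
    {x, y, z} ∈ B.triangles ↔ ¬ B.rel x y z ∧ ¬ B.rel y x z ∧ ¬ B.rel y z x := by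
  simp only [triangles, Set.mem_ofPred_eq, h.isCollinear_iff hxy hxz hyz,
    Finset.card_eq_three.2 ⟨x, y, z, hxy, hxz, hyz, rfl⟩]
  tauto

/-- Among five points without triangles, four are linearly ordered. -/
theorem IsAlmostMetrizable.exists_four_of_five (h : B.IsAlmostMetrizable) (S : Set X)
    (hS : ∀ u ∈ S, ∀ v ∈ S, ∀ w ∈ S, u ≠ v → u ≠ w → v ≠ w →
      B.rel u v w ∨ B.rel v u w ∨ B.rel v w u)
    {a b c x y : X} (ha : a ∈ S) (hb : b ∈ S) (hc : c ∈ S) (hx : x ∈ S) (hy : y ∈ S)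
    (hnd : [a, b, c, x, y].Nodup) (habc : B.rel a b c) :
    ∃ u ∈ S, ∃ v ∈ S, ∃ w ∈ S, ∃ z ∈ S, [u, v, w, z].Nodup ∧ B.rel u v w ∧ B.rel u w z := by
  by_contra hno
  have key : ∀ u ∈ S, ∀ v ∈ S, ∀ w ∈ S, ∀ z ∈ S, [u, v, w, z].Nodup →
      B.rel u v w → B.rel u w z → False :=
    fun u hu v hv w hw z hz h1 h2 h3 => hno ⟨u, hu, v, hv, w, hw, z, hz, h1, h2, h3⟩
  -- Without a line on four points, any fourth point x closes a 4-cycle a, b, c, x, in which b and x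
  -- are opposite.
  have square : ∀ a ∈ S, ∀ b ∈ S, ∀ c ∈ S, ∀ x ∈ S, [a, b, c, x].Nodup → B.rel a b c →
      B.rel x a b ∧ B.rel x c b ∧ B.rel a x c := by
    intro a ha b hb c hc x hx hnd habc
    have hcba := h.symm _ _ _ habc
    simp only [List.nodup_cons, List.mem_cons, List.not_mem_nil, not_or, not_false_eq_true,
      List.nodup_nil, and_true, or_false] at hnd
    obtain ⟨⟨hab, hac, hax⟩, ⟨hbc, hbx⟩, hcx⟩ := hnd
    have hm : B.rel a x c := by
      rcases hS a ha c hc x hx hac hax hcx with h1 | h1 | h1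
      · exact (key a ha b hb c hc x hx (by clear hno key hS; simp; tauto) habc h1).elim
      · exact (key c hc b hb a ha x hx (by clear hno key hS; simp; tauto) hcba h1).elim
      · exact h.symm _ _ _ h1
    have hm' := h.symm _ _ _ hm
    refine ⟨?_, ?_, hm⟩
    · rcases hS a ha b hb x hx hab hax hbx with h1 | h1 | h1
      · exact (key a ha b hb x hx c hc (by clear hno key hS; simp; tauto) h1 hm).elim
      · exact h.symm _ _ _ h1
      · exact (key a ha x hx b hb c hc (by clear hno key hS; simp; tauto) (h.symm _ _ _ h1) habc).elim
    · rcases hS c hc b hb x hx (Ne.symm hbc) hcx hbx with h1 | h1 | h1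
      · exact (key c hc b hb x hx a ha (by clear hno key hS; simp; tauto) h1 hm').elim
      · exact h.symm _ _ _ h1
      · exact (key c hc x hx b hb a ha (by clear hno key hS; simp; tauto) (h.symm _ _ _ h1) hcba).elim
  simp only [List.nodup_cons, List.mem_cons, List.not_mem_nil, not_or, not_false_eq_true,
    List.nodup_nil, and_true, or_false] at hnd
  obtain ⟨⟨hab, hac, hax, hay⟩, ⟨hbc, hbx, hby⟩, ⟨hcx, hcy⟩, hxy⟩ := hnd
  obtain ⟨hxab, -, -⟩ := square a ha b hb c hc x hx (by clear hno key hS square; simp; tauto) habc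
  obtain ⟨hyab, -, -⟩ := square a ha b hb c hc y hy (by clear hno key hS square; simp; tauto) habc
  -- Both x and y are now opposite to b across a, so any collinearity of b, x, y yields a line of
  -- four points.
  rcases hS b hb x hx y hy hbx hby hxy with h1 | h1 | h1
  · exact key b hb a ha x hx y hy (by clear hno key hS square; simp; tauto) (h.symm _ _ _ hxab) h1
  · exact key x hx a ha b hb y hy (by clear hno key hS square; simp; tauto) hxab h1
  · exact key b hb a ha y hy x hx (by clear hno key hS square; simp; tauto) (h.symm _ _ _ hyab) (h.symm _ _ _ h1)

theorem IsAlmostMetrizable.isLine_four (h : B.IsAlmostMetrizable) {u v w z : X}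
    (hnd : [u, v, w, z].Nodup) (h1 : B.rel u v w) (h2 : B.rel u w z) :
    B.IsLine 4 fun a => if a = 0 then u else if a = 1 then v else if a = 2 then w else z := by
  obtain ⟨h3, h4⟩ := h.four_relations _ _ _ _ h2 h1
  simp only [List.nodup_cons, List.mem_cons, List.not_mem_nil, not_or, not_false_eq_true,
    List.nodup_nil, and_true, or_false] at hnd
  constructor
  · intro a b hab hb
    interval_cases b <;> interval_cases a <;> simp <;> tauto
  · intro a b c hab hbc hc
    interval_cases c <;> interval_cases b <;> interval_cases a <;> simp <;> assumption

/-- Five points without triangles are linearly ordered. -/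
theorem IsAlmostMetrizable.exists_isLine_five [DecidableEq X] (h : B.IsAlmostMetrizable)
    (S : Finset X) (hcard : S.card = 5) (hS : ∀ T ∈ B.triangles, ¬ T ⊆ S) :
    ∃ p, B.IsLine 5 p := by
  have hfree : ∀ u ∈ S, ∀ v ∈ S, ∀ w ∈ S, u ≠ v → u ≠ w → v ≠ w →
      B.rel u v w ∨ B.rel v u w ∨ B.rel v w u := by
    intro u hu v hv w hw huv huw hvw
    by_contra hno
    refine hS {u, v, w} ((h.mem_triangles_iff huv huw hvw).2 (by tauto)) ?_
    intro t ht
    simp only [Finset.mem_insert, Finset.mem_singleton] at ht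
    rcases ht with rfl | rfl | rfl <;> assumption
  have hlist : ∃ l : List X, l.Nodup ∧ l.length = 5 ∧ ∀ t ∈ l, t ∈ S :=
    ⟨S.toList, S.nodup_toList, by simpa using hcard, fun t => by simp⟩
  obtain ⟨l, hl, hlen, hmem⟩ := hlist
  obtain ⟨a, b, c, x, y, rfl⟩ : ∃ a b c x y, l = [a, b, c, x, y] := by
    rcases l with _ | ⟨a, _ | ⟨b, _ | ⟨c, _ | ⟨x, _ | ⟨y, _ | ⟨_, l⟩⟩⟩⟩⟩⟩ <;> simp at hlen
    exact ⟨a, b, c, x, y, rfl⟩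
  simp only [List.mem_cons, List.not_mem_nil, or_false, forall_eq_or_imp, forall_eq] at hmem
  obtain ⟨ha, hb, hc, hx, hy⟩ := hmem
  have hfour : ∃ u ∈ S, ∃ v ∈ S, ∃ w ∈ S, ∃ z ∈ S,
      [u, v, w, z].Nodup ∧ B.rel u v w ∧ B.rel u w z := by
    have hnd := hl
    simp only [List.nodup_cons, List.mem_cons, List.not_mem_nil, not_or, not_false_eq_true,
      List.nodup_nil, and_true, or_false] at hnd
    have hfree' : ∀ u ∈ (S : Set X), ∀ v ∈ (S : Set X), ∀ w ∈ (S : Set X), u ≠ v → u ≠ w →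
      v ≠ w → B.rel u v w ∨ B.rel v u w ∨ B.rel v w u := hfree
    rcases hfree a ha b hb c hc hnd.1.1 hnd.1.2.1 hnd.2.1.1 with h1 | h1 | h1
    · exact h.exists_four_of_five S hfree' ha hb hc hx hy hl h1
    · exact h.exists_four_of_five S hfree' hb ha hc hx hy
        (by clear hfree hfree' hS; simp; tauto) h1
    · exact h.exists_four_of_five S hfree' hb hc ha hx hy
        (by clear hfree hfree' hS; simp; tauto) h1
  obtain ⟨u, hu, v, hv, w, hw, z, hz, hnd, h1, h2⟩ := hfour
  have hp := h.isLine_four hnd h1 h2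
  obtain ⟨p, hp, hpS⟩ : ∃ p, B.IsLine 4 p ∧ ∀ a, p a ∈ S :=
    ⟨_, hp, fun a => by split_ifs <;> assumption⟩
  obtain ⟨t, ht, hpt⟩ : ∃ t ∈ S, ∀ a < 4, p a ≠ t := by
    by_contra hno
    push Not at hno
    have : S ⊆ (Finset.range 4).image p := fun t ht => by
      obtain ⟨a, ha, hat⟩ := hno t ht
      exact Finset.mem_image.2 ⟨a, Finset.mem_range.2 ha, hat⟩
    have := (Finset.card_le_card this).trans Finset.card_image_le
    simp [hcard] at this
  by_contra hno
  have hins := fun hi => hno (let ⟨p', hp', _⟩ := hp.exists_insert hpt hi; ⟨p', hp'⟩)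
  -- Already for k = 4 the bound k - 3 produces a triangle inside `S`, so the fifth point must fit.
  have hpairs : 4 ≤ (B.linePairs 4 p t).card + 3 :=
    ((h.extensionPattern hp hpt).card_trianglePairs le_rfl hins).1
  obtain ⟨⟨a, b⟩, hab⟩ := Finset.card_pos.1 (show 0 < (B.linePairs 4 p t).card by omega)
  obtain ⟨hb, hlt, h3, h4, h5⟩ := ExtensionPattern.mem_trianglePairs.1 hab
  have := hfree t ht (p a) (hpS a) (p b) (hpS b) (hpt a (by omega)).symm (hpt b hb).symm
    (hp.ne a b hlt hb)
  tauto

end BetweennessStructure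

/-! ### Counting triangles off a line, and the gap -/

namespace BetweennessStructure

variable {X : Type*} {B : BetweennessStructure X}

theorem IsAlmostMetrizable.mem_linePairs_iff [DecidableEq X] (h : B.IsAlmostMetrizable) {k : ℕ}
    {p : ℕ → X} (hp : B.IsLine k p) {x : X} (hx : ∀ a < k, p a ≠ x) {a b : ℕ} (hab : a < b)
    (hb : b < k) : (a, b) ∈ B.linePairs k p x ↔ {x, p a, p b} ∈ B.triangles := by
  rw [h.mem_triangles_iff (hx a (by omega)).symm (hx b hb).symm (hp.ne a b hab hb),
    ExtensionPattern.mem_trianglePairs]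
  tauto

/-- A triangle with exactly one point off the line determines that point and, through a < b, its
pair on the line; so nothing is counted twice. -/
theorem IsAlmostMetrizable.sum_card_linePairs_le [Fintype X] [DecidableEq X]
    (h : B.IsAlmostMetrizable) {k : ℕ} {p : ℕ → X} (hp : B.IsLine k p) (S : Finset X)
    (hS : ∀ x ∈ S, ∀ a < k, p a ≠ x) :
    ∑ x ∈ S, (B.linePairs k p x).card ≤ B.coSize := by
  rw [coSize, Set.ncard_eq_toFinset_card _ (Set.toFinite _), ← Finset.card_sigma]
  refine Finset.card_le_card_of_injOn (fun e => {e.1, p e.2.1, p e.2.2}) ?_ ?_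
  · rintro ⟨x, a, b⟩ he
    simp only [Finset.coe_sigma, Set.mem_sigma_iff, Finset.mem_coe] at he
    obtain ⟨hb, hab, -⟩ := ExtensionPattern.mem_trianglePairs.1 he.2
    rw [Finset.mem_coe, Set.Finite.mem_toFinset]
    exact (h.mem_linePairs_iff hp (hS x he.1) hab hb).1 he.2
  · rintro ⟨x, a, b⟩ he ⟨y, c, d⟩ hf hef
    simp only [Finset.coe_sigma, Set.mem_sigma_iff, Finset.mem_coe] at he hf
    obtain ⟨hb, hab, -⟩ := ExtensionPattern.mem_trianglePairs.1 he.2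
    obtain ⟨hd, hcd, -⟩ := ExtensionPattern.mem_trianglePairs.1 hf.2
    have key : ∀ t, (t = x ∨ t = p a ∨ t = p b) → (t = y ∨ t = p c ∨ t = p d) := fun t => by
      have := Finset.ext_iff.1 hef t
      simp only [Finset.mem_insert, Finset.mem_singleton] at this
      exact this.1
    obtain rfl : x = y := by
      rcases key x (by simp) with h1 | h1 | h1
      · exact h1
      · exact (hS x he.1 c (by omega) h1.symm).elim
      · exact (hS x he.1 d hd h1.symm).elim
    have hac : a = c ∨ a = d := by
      rcases key (p a) (by simp) with h1 | h1 | h1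
      · exact (hS x he.1 a (by omega) h1).elim
      · exact Or.inl (hp.injOn (by omega) (by omega) h1)
      · exact Or.inr (hp.injOn (by omega) (by omega) h1)
    have hbd : b = c ∨ b = d := by
      rcases key (p b) (by simp) with h1 | h1 | h1
      · exact (hS x he.1 b (by omega) h1).elim
      · exact Or.inl (hp.injOn (by omega) (by omega) h1)
      · exact Or.inr (hp.injOn (by omega) (by omega) h1)
    obtain rfl : a = c := by omega
    obtain rfl : b = d := by omega
    rfl

theorem IsLine.card_image [DecidableEq X] {k : ℕ} {p : ℕ → X} (hp : B.IsLine k p) :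
    ((Finset.range k).image p).card = k := by
  rw [Finset.card_image_of_injOn, Finset.card_range]
  intro a ha b hb hab
  exact hp.injOn (by simpa using ha) (by simpa using hb) hab

/-- A triangle is not contained in a line. -/
theorem IsAlmostMetrizable.not_subset_line [DecidableEq X] (h : B.IsAlmostMetrizable) {k : ℕ}
    {p : ℕ → X} (hp : B.IsLine k p) {T : Finset X} (hT : T ∈ B.triangles) :
    ∃ x ∈ T, ∀ a < k, p a ≠ x := by
  by_contra hno
  push Not at hno
  have hT3 : T.card = 3 := hT.1
  obtain ⟨u, v, w, huv, huw, hvw, rfl⟩ := Finset.card_eq_three.1 hT3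
  have hcol := (h.mem_triangles_iff huv huw hvw).1 hT
  obtain ⟨a, ha, rfl⟩ := hno u (by simp)
  obtain ⟨b, hb, rfl⟩ := hno v (by simp)
  obtain ⟨c, hc, rfl⟩ := hno w (by simp)
  have hab : a ≠ b := fun e => huv (by rw [e])
  have hac : a ≠ c := fun e => huw (by rw [e])
  have hbc : b ≠ c := fun e => hvw (by rw [e])
  have sy := fun {x y z} (e : ¬ B.rel x y z) (e' : B.rel z y x) => e (h.symm _ _ _ e')
  rcases Nat.lt_or_ge a b with h1 | h1 <;> rcases Nat.lt_or_ge b c with h2 | h2 <;>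
    rcases Nat.lt_or_ge a c with h3 | h3
  · exact hcol.1 (hp.rel a b c h1 h2 hc)
  · omega
  · exact sy hcol.2.2 (hp.rel a c b h3 (by omega) hb)
  · exact sy hcol.2.1 (hp.rel c a b (by omega) h1 hb)
  · exact hcol.2.1 (hp.rel b a c (by omega) h3 hc)
  · exact hcol.2.2 (hp.rel b c a h2 (by omega) ha)
  · omega
  · exact sy hcol.1 (hp.rel c b a (by omega) (by omega) ha)

theorem coSize_le_of_common_pair [Fintype X] [DecidableEq X] {x y : X} (hxy : x ≠ y)
    (hT : ∀ T ∈ B.triangles, x ∈ T ∧ y ∈ T) : B.coSize ≤ Fintype.card X - 2 := by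
  have hsub : B.triangles ⊆
      (((Finset.univ \ {x, y}).image fun z => ({x, y, z} : Finset X)) : Finset (Finset X)) := by
    intro T h
    obtain ⟨hx, hy⟩ := hT T h
    have hpair : ({x, y} : Finset X) ⊆ T := by
      intro t ht
      simp only [Finset.mem_insert, Finset.mem_singleton] at ht
      rcases ht with rfl | rfl <;> assumption
    have hT3 : T.card = 3 := h.1
    have h1 := Finset.card_sdiff_add_card_eq_card hpair
    rw [Finset.card_pair hxy] at h1
    obtain ⟨z, hz⟩ := Finset.card_eq_one.1 (show (T \ {x, y}).card = 1 by omega)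
    have hzT : z ∈ T \ {x, y} := by rw [hz]; simp
    simp only [Finset.coe_image, Set.mem_image, Finset.mem_coe]
    refine ⟨z, by simpa using (Finset.mem_sdiff.1 hzT).2, ?_⟩
    rw [← Finset.sdiff_union_of_subset hpair, hz]
    ext t
    simp only [Finset.mem_insert, Finset.mem_singleton, Finset.mem_union]
    tauto
  refine (Set.ncard_le_ncard hsub (Set.toFinite _)).trans ?_
  rw [Set.ncard_coe_finset]
  refine Finset.card_image_le.trans ?_
  rw [Finset.card_sdiff_of_subset (Finset.subset_univ _), Finset.card_pair hxy, Finset.card_univ]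

theorem exists_isLine_max [Fintype X] [DecidableEq X] {p : ℕ → X} {k₀ : ℕ} (hp : B.IsLine k₀ p) :
    ∃ k ≥ k₀, ∃ p, B.IsLine k p ∧ ∀ p', ¬ B.IsLine (k + 1) p' := by
  classical
  have hle : ∀ k, (∃ p, B.IsLine k p) → k ≤ Fintype.card X := by
    rintro k ⟨p, hp⟩
    rw [← hp.card_image]
    exact Finset.card_le_univ _
  refine ⟨Nat.findGreatest (fun k => ∃ p, B.IsLine k p) (Fintype.card X),
    Nat.le_findGreatest (hle _ ⟨p, hp⟩) ⟨p, hp⟩, ?_⟩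
  obtain ⟨q, hq⟩ := Nat.findGreatest_spec (P := fun k => ∃ p, B.IsLine k p)
    (hle _ ⟨p, hp⟩) ⟨p, hp⟩
  refine ⟨q, hq, fun p' hp' => ?_⟩
  have := Nat.le_findGreatest (P := fun k => ∃ p, B.IsLine k p) (hle _ ⟨p', hp'⟩) ⟨p', hp'⟩
  omega

/-- The gap between the co-sizes `n - 2` and `2 n - 10`. -/
theorem IsAlmostMetrizable.coSize_gap [Finite X] (h : B.IsAlmostMetrizable)
    (hm : Nat.card X - 2 < B.coSize) : 2 * Nat.card X - 10 ≤ B.coSize := by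
  classical
  have := Fintype.ofFinite X
  rw [Nat.card_eq_fintype_card] at *
  by_contra hlt
  have hfive : ∃ S : Finset X, S.card = 5 ∧ ∀ T ∈ (Set.toFinite B.triangles).toFinset, ¬ T ⊆ S := by
    refine Finset.exists_five_of_few_triples _ (fun T hT => ?_) (Fintype.card X) (by omega)
      Finset.univ Finset.card_univ ?_
    · exact ((Set.Finite.mem_toFinset _).1 hT).1
    · rw [Finset.filter_true_of_mem fun T _ => Finset.subset_univ T,
        ← Set.ncard_eq_toFinset_card]
      change B.coSize + 11 ≤ _
      omega
  obtain ⟨S, hS5, hS⟩ := hfive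
  obtain ⟨p₀, hp₀⟩ := h.exists_isLine_five S hS5
    fun T hT => hS T ((Set.Finite.mem_toFinset _).2 hT)
  obtain ⟨k, hk, p, hp, hmax⟩ := exists_isLine_max hp₀
  set off : Finset X := Finset.univ \ (Finset.range k).image p with hoffdef
  have hoff : ∀ x, x ∈ off ↔ ∀ a < k, p a ≠ x := fun x => by simp [hoffdef]
  have hcard : off.card + k = Fintype.card X := by
    rw [← hp.card_image, ← Finset.card_univ]
    exact Finset.card_sdiff_add_card_eq_card (Finset.subset_univ _)
  have hext := fun x (hx : x ∈ off) =>
    (h.extensionPattern hp ((hoff x).1 hx)).card_trianglePairs (by omega) fun hi =>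
      let ⟨p', hp', _⟩ := hp.exists_insert ((hoff x).1 hx) hi
      hmax p' hp'
  have hsum := h.sum_card_linePairs_le hp off fun x hx => (hoff x).1 hx
  -- Maximality of the line rules out insertion, so each outside point contributes at least k - 3
  -- triangles.
  have hlow : off.card * (k - 3) ≤ B.coSize := by
    refine le_trans ?_ hsum
    rw [← smul_eq_mul]
    refine Finset.card_nsmul_le_sum _ _ _ fun x hx => ?_
    have : k ≤ (B.linePairs k p x).card + 3 := (hext x hx).1
    omega
  obtain ⟨r, rfl⟩ : ∃ r, k = r + 5 := ⟨k - 5, by omega⟩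
  rcases Nat.lt_or_ge off.card 2 with hc | hc
  · have hpos : 0 < off.card := by
      have : B.triangles.Nonempty := by
        rw [← Set.ncard_pos (Set.toFinite _)]
        change 0 < B.coSize
        omega
      obtain ⟨T, hT⟩ := this
      obtain ⟨x, -, hx⟩ := h.not_subset_line hp hT
      exact Finset.card_pos.2 ⟨x, (hoff x).2 hx⟩
    obtain ⟨x, hx⟩ := Finset.card_eq_one.1 (show off.card = 1 by omega)
    have hxoff : x ∈ off := by rw [hx]; simp
    rw [hx, Finset.sum_singleton] at hsum
    -- With x the only outside point, every triangle contains x; a common second point y contradicts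
    -- the assumption of more than n - 2 triangles.
    rcases (hext x hxoff).2 with ⟨y, hy, hstar⟩ | hbig
    · have hxl := (hoff x).1 hxoff
      have := coSize_le_of_common_pair (B := B) (hxl y hy).symm fun T hT => by
        obtain ⟨z, hz, hzl⟩ := h.not_subset_line hp hT
        have hzoff := (hoff z).2 hzl
        rw [hx, Finset.mem_singleton] at hzoff
        subst hzoff
        refine ⟨hz, ?_⟩
        have hT3 : T.card = 3 := hT.1
        have h2 := Finset.card_erase_of_mem hz
        obtain ⟨u, v, huv, he⟩ := Finset.card_eq_two.1 (show (T.erase z).card = 2 by omega)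
        have hline : ∀ t, t ∈ T.erase z → ∃ a < r + 5, p a = t := by
          intro t ht
          by_contra hno
          push Not at hno
          have := (hoff t).2 hno
          rw [hx, Finset.mem_singleton] at this
          exact (Finset.mem_erase.1 ht).1 this
        have hTe : T = {z, u, v} := by rw [← Finset.insert_erase hz, he]
        obtain ⟨a, ha, rfl⟩ := hline u (by rw [he]; simp)
        obtain ⟨b, hb, rfl⟩ := hline v (by rw [he]; simp)
        rcases lt_trichotomy a b with hab | hab | hab
        · rw [hTe, ← h.mem_linePairs_iff hp hxl hab hb] at hT
          rw [hTe]
          rcases hstar _ hT with rfl | rfl <;> simp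
        · exact (huv (by rw [hab])).elim
        · rw [hTe, Finset.pair_comm, ← h.mem_linePairs_iff hp hxl hab ha] at hT
          rw [hTe]
          rcases hstar _ hT with rfl | rfl <;> simp
      omega
    · have : 2 * (r + 5) ≤ (B.linePairs (r + 5) p x).card + 8 := hbig
      omega
  -- Here n = r + s + 7 and 2n - 10 = 2r + 2s + 4, which (s + 2)(r + 2) exceeds by sr.
  · obtain ⟨s, hs⟩ : ∃ s, off.card = s + 2 := ⟨off.card - 2, by omega⟩
    rw [hs, show r + 5 - 3 = r + 2 by omega,
      show (s + 2) * (r + 2) = s * r + 2 * s + 2 * r + 4 by ring] at hlow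
    have := Nat.zero_le (s * r)
    omega

end BetweennessStructure

/-! ### Metrics attaining the minimum -/

namespace BetweennessStructure

/-- `d` restricts to a metric on `0, …, n - 1`. -/
structure IsDist (n : ℕ) (d : ℕ → ℕ → ℕ) : Prop where
  eq_zero_iff : ∀ a < n, ∀ b < n, d a b = 0 ↔ a = b
  comm : ∀ a < n, ∀ b < n, d a b = d b a
  triangle : ∀ a < n, ∀ b < n, ∀ c < n, d a c ≤ d a b + d b c

/-- The betweenness structure of a metric on `0, …, n - 1`. -/
def ofDist (n : ℕ) (d : ℕ → ℕ → ℕ) : BetweennessStructure (ULift.{u} (Fin n)) where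
  rel x y z := d x.down y.down + d y.down z.down = d x.down z.down

theorem IsDist.isAlmostMetrizable {n : ℕ} {d : ℕ → ℕ → ℕ} (hd : IsDist n d) :
    (ofDist.{u} n d).IsAlmostMetrizable where
  left_mem x z := by
    have := (hd.eq_zero_iff x.down x.down.2 x.down x.down.2).2 rfl
    change d x.down x.down + d x.down z.down = d x.down z.down
    omega
  symm x y z h := by
    change d x.down y.down + d y.down z.down = d x.down z.down at h
    change d z.down y.down + d y.down x.down = d z.down x.down
    rw [hd.comm z.down z.down.2 y.down y.down.2, hd.comm y.down y.down.2 x.down x.down.2,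
      hd.comm z.down z.down.2 x.down x.down.2]
    omega
  eq_of_rel x y z h h' := by
    change d x.down y.down + d y.down z.down = d x.down z.down at h
    change d y.down x.down + d x.down z.down = d y.down z.down at h'
    have := (hd.eq_zero_iff x.down x.down.2 y.down y.down.2).1 (by omega)
    exact ULift.ext _ _ (Fin.ext this)
  four_relations x y z w h h' := by
    change d x.down y.down + d y.down z.down = d x.down z.down at h
    change d x.down w.down + d w.down y.down = d x.down y.down at h'
    have h1 := hd.triangle x.down x.down.2 w.down w.down.2 z.down z.down.2
    have h2 := hd.triangle w.down w.down.2 y.down y.down.2 z.down z.down.2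
    constructor
    · change d x.down w.down + d w.down z.down = d x.down z.down
      omega
    · change d w.down y.down + d y.down z.down = d w.down z.down
      omega

/-- The triangles of a metric, listed in increasing order of their points. -/
def distTriangles (n : ℕ) (d : ℕ → ℕ → ℕ) : Finset (ℕ × ℕ × ℕ) :=
  (Finset.range n ×ˢ Finset.range n ×ˢ Finset.range n).filter fun t =>
    t.1 < t.2.1 ∧ t.2.1 < t.2.2 ∧ d t.1 t.2.1 + d t.2.1 t.2.2 ≠ d t.1 t.2.2 ∧
      d t.2.1 t.1 + d t.1 t.2.2 ≠ d t.2.1 t.2.2 ∧ d t.2.1 t.2.2 + d t.2.2 t.1 ≠ d t.2.1 t.1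

theorem mem_distTriangles {n : ℕ} {d : ℕ → ℕ → ℕ} {a b c : ℕ} :
    (a, b, c) ∈ distTriangles n d ↔ (a < b ∧ b < c ∧ c < n) ∧ d a b + d b c ≠ d a c ∧
      d b a + d a c ≠ d b c ∧ d b c + d c a ≠ d b a := by
  simp only [distTriangles, Finset.mem_filter, Finset.mem_product, Finset.mem_range]
  constructor
  · rintro ⟨⟨-, -, h⟩, h1, h2, h3⟩; exact ⟨⟨h1, h2, h⟩, h3⟩
  · rintro ⟨⟨h1, h2, h⟩, h3⟩; exact ⟨⟨by omega, by omega, h⟩, h1, h2, h3⟩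

theorem IsDist.coSize_eq {n : ℕ} {d : ℕ → ℕ → ℕ} (hd : IsDist n d) (hn : 0 < n) :
    (ofDist.{u} n d).coSize = (distTriangles n d).card := by
  have h := hd.isAlmostMetrizable
  -- Reduction modulo n only makes `pt` total; indices below n are unchanged.
  let pt : ℕ → ULift.{u} (Fin n) := fun i => ⟨⟨i % n, Nat.mod_lt i hn⟩⟩
  have hval : ∀ i < n, ((pt i).down : ℕ) = i := fun i hi => Nat.mod_eq_of_lt hi
  have hpt : ∀ x : ULift.{u} (Fin n), ∃ i < n, pt i = x := fun x =>
    ⟨x.down, x.down.2, ULift.ext _ _ (Fin.ext (hval _ x.down.2))⟩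
  have hinj : ∀ i < n, ∀ j < n, pt i = pt j → i = j := fun i hi j hj hij => by
    rw [← hval i hi, ← hval j hj, hij]
  have hmem : ∀ a b c, a < b → b < c → c < n →
      ({pt a, pt b, pt c} ∈ (ofDist.{u} n d).triangles ↔ (a, b, c) ∈ distTriangles n d) := by
    intro a b c hab hbc hc
    have hne : ∀ i j, i < j → j < n → pt i ≠ pt j := fun i j hij hj he =>
      absurd (hinj i (by omega) j hj he) (by omega)
    rw [h.mem_triangles_iff (hne a b hab (by omega)) (hne a c (by omega) hc) (hne b c hbc hc),
      mem_distTriangles]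
    simp only [hab, hbc, hc, ofDist, hval a (by omega), hval b (by omega), hval c hc]
    tauto
  rw [coSize, ← Set.ncard_coe_finset]
  symm
  refine Set.ncard_congr (fun t _ => {pt t.1, pt t.2.1, pt t.2.2}) ?_ ?_ ?_
  · rintro ⟨a, b, c⟩ ht
    have ht' := Finset.mem_coe.1 ht
    obtain ⟨⟨h1, h2, h3⟩, -⟩ := mem_distTriangles.1 ht'
    exact (hmem a b c h1 h2 h3).2 ht'
  · rintro ⟨a, b, c⟩ ⟨a', b', c'⟩ ht ht' he
    obtain ⟨⟨h1, h2, h3⟩, -⟩ := mem_distTriangles.1 (Finset.mem_coe.1 ht)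
    obtain ⟨⟨h1', h2', h3'⟩, -⟩ := mem_distTriangles.1 (Finset.mem_coe.1 ht')
    have key : ∀ i < n, (i = a ∨ i = b ∨ i = c) → (i = a' ∨ i = b' ∨ i = c') := by
      intro i hi hi'
      have := (Finset.ext_iff.1 he (pt i)).1
      simp only [Finset.mem_insert, Finset.mem_singleton] at this
      rcases this (by rcases hi' with rfl | rfl | rfl <;> simp) with h | h | h
      · exact Or.inl (hinj _ hi _ (by omega) h)
      · exact Or.inr (Or.inl (hinj _ hi _ (by omega) h))
      · exact Or.inr (Or.inr (hinj _ hi _ h3' h))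
    have ka := key a (by omega) (by simp)
    have kb := key b (by omega) (by simp)
    have kc := key c (by omega) (by simp)
    obtain ⟨rfl, rfl, rfl⟩ : a = a' ∧ b = b' ∧ c = c' := by omega
    rfl
  · intro T hT
    have hT3 : T.card = 3 := hT.1
    obtain ⟨x, y, z, hxy, hxz, hyz, rfl⟩ := Finset.card_eq_three.1 hT3
    obtain ⟨a, ha, rfl⟩ := hpt x
    obtain ⟨b, hb, rfl⟩ := hpt y
    obtain ⟨c, hc, rfl⟩ := hpt z
    have main : ∀ a b c, a < b → b < c → c < n → {pt a, pt b, pt c} ∈ (ofDist.{u} n d).triangles →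
        ∃ t, ∃ _ : t ∈ ((distTriangles n d : Finset _) : Set (ℕ × ℕ × ℕ)),
          ({pt t.1, pt t.2.1, pt t.2.2} : Finset (ULift.{u} (Fin n))) = {pt a, pt b, pt c} :=
      fun a b c hab hbc hc hT => ⟨_, Finset.mem_coe.2 ((hmem a b c hab hbc hc).1 hT), rfl⟩
    have hab : a ≠ b := fun e => hxy (by rw [e])
    have hac : a ≠ c := fun e => hxz (by rw [e])
    have hbc : b ≠ c := fun e => hyz (by rw [e])
    have e1 : ({pt a, pt c, pt b} : Finset (ULift.{u} (Fin n))) = {pt a, pt b, pt c} := by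
      rw [Finset.pair_comm]
    have e2 : ({pt b, pt a, pt c} : Finset (ULift.{u} (Fin n))) = {pt a, pt b, pt c} :=
      Finset.insert_comm _ _ _
    have e3 : ({pt b, pt c, pt a} : Finset (ULift.{u} (Fin n))) = {pt a, pt b, pt c} := by
      rw [Finset.pair_comm, e2]
    have e4 : ({pt c, pt a, pt b} : Finset (ULift.{u} (Fin n))) = {pt a, pt b, pt c} := by
      rw [Finset.insert_comm, e1]
    have e5 : ({pt c, pt b, pt a} : Finset (ULift.{u} (Fin n))) = {pt a, pt b, pt c} := by
      rw [Finset.pair_comm, e4]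
    rcases lt_or_gt_of_ne hab with h1 | h1 <;> rcases lt_or_gt_of_ne hbc with h2 | h2 <;>
      rcases lt_or_gt_of_ne hac with h3 | h3
    · exact main a b c h1 h2 hc hT
    · omega
    · rw [← e1] at hT ⊢; exact main a c b h3 h2 hb hT
    · rw [← e4] at hT ⊢; exact main c a b h3 h1 hb hT
    · rw [← e2] at hT ⊢; exact main b a c h1 h3 hc hT
    · rw [← e3] at hT ⊢; exact main b c a h2 h3 ha hT
    · omega
    · rw [← e5] at hT ⊢; exact main c b a h2 h1 ha hT

theorem IsDist.existsAlmostMetrizable {n : ℕ} {d : ℕ → ℕ → ℕ} (hd : IsDist n d) (hn : 0 < n) :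
    ExistsAlmostMetrizable.{u} n (distTriangles n d).card :=
  ⟨ULift.{u} (Fin n), inferInstance, ⟨⟨⟨0, hn⟩⟩⟩, ofDist n d, hd.isAlmostMetrizable, by simp,
    hd.coSize_eq hn⟩

/-- The level of a point in a path in which the second and third vertices have been doubled. -/
def level (a : ℕ) : ℕ :=
  if a = 0 then 0 else if a ≤ 2 then 1 else if a ≤ 4 then 2 else a - 2

/-- The distance in a path in which the second and third vertices have been doubled. -/
def levelDist (a b : ℕ) : ℕ :=
  if a = b then 0 else if level a = level b then 2 else
    (level a - level b) + (level b - level a)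

theorem isDist_levelDist (n : ℕ) : IsDist n levelDist where
  eq_zero_iff a _ b _ := by
    unfold levelDist
    constructor <;> intro h <;> split_ifs at * <;> omega
  comm a _ b _ := by unfold levelDist; split_ifs <;> omega
  triangle a _ b _ c _ := by unfold levelDist; split_ifs <;> subst_vars <;> omega

theorem level_mono {a b : ℕ} (h : a < b) : level a ≤ level b := by
  unfold level; split_ifs <;> omega

theorem level_eq_iff {a b : ℕ} (h : a < b) :
    level a = level b ↔ (a = 1 ∧ b = 2) ∨ (a = 3 ∧ b = 4) := by
  unfold level
  constructor <;> intro h' <;> split_ifs at * <;> omega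

/-- Twins are at distance 2, so a third point is collinear with them exactly when its level is
adjacent to theirs, and then it lies between them. Triples without twins are collinear as in the
path. -/
theorem distTriangles_levelDist {n : ℕ} (hn : 5 ≤ n) : distTriangles n levelDist =
    (Finset.Ico 5 n).image (fun c => (1, 2, c)) ∪ (Finset.Ico 6 n).image (fun c => (3, 4, c)) ∪
      {(0, 3, 4)} := by
  ext ⟨a, b, c⟩
  rw [mem_distTriangles]
  simp only [Finset.mem_union, Finset.mem_image, Finset.mem_Ico, Finset.mem_singleton,
    Prod.mk.injEq]
  have hR : ((∃ x, (5 ≤ x ∧ x < n) ∧ 1 = a ∧ 2 = b ∧ x = c) ∨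
      ∃ x, (6 ≤ x ∧ x < n) ∧ 3 = a ∧ 4 = b ∧ x = c) ↔
      (5 ≤ c ∧ c < n ∧ a = 1 ∧ b = 2) ∨ (6 ≤ c ∧ c < n ∧ a = 3 ∧ b = 4) := by
    constructor
    · rintro (⟨x, h, rfl, rfl, rfl⟩ | ⟨x, h, rfl, rfl, rfl⟩) <;> omega
    · rintro (h | h)
      · exact Or.inl ⟨c, by omega⟩
      · exact Or.inr ⟨c, by omega⟩
  rw [hR]
  by_cases hlt : a < b ∧ b < c ∧ c < n
  swap
  · simp only [hlt, false_and, false_iff]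
    omega
  obtain ⟨hab, hbc, hc⟩ := hlt
  have h1 := level_mono hab
  have h2 := level_mono hbc
  have h3 := level_eq_iff hab
  have h4 := level_eq_iff hbc
  have h5 : ∀ x y, x < y → levelDist x y = if level x = level y then 2 else level y - level x := by
    intro x y hxy
    have := level_mono hxy
    unfold levelDist
    split_ifs <;> omega
  have h6 : ∀ x y, x < y → levelDist y x = if level x = level y then 2 else level y - level x := by
    intro x y hxy
    have := level_mono hxy
    unfold levelDist
    split_ifs <;> omega
  rw [h5 a b hab, h5 b c hbc, h5 a c (by omega), h6 a b hab, h6 a c (by omega)]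
  have hc' : c = 0 ∨ c ≤ 4 ∨ 5 ≤ c ∧ level c = c - 2 := by
    unfold level; split_ifs <;> omega
  have l1 : level 1 = 1 := rfl
  have l2 : level 2 = 1 := rfl
  have l3 : level 3 = 2 := rfl
  have l4 : level 4 = 2 := rfl
  have l0 : level 0 = 0 := rfl
  by_cases e1 : level a = level b
  · rcases h3.1 e1 with ⟨rfl, rfl⟩ | ⟨rfl, rfl⟩
    · by_cases c3 : c = 3
      · subst c3; simp [l1, l2, l3]
      by_cases c4 : c = 4
      · subst c4; simp [l1, l2, l4]
      split_ifs <;> omega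
    · split_ifs <;> omega
  · by_cases e2 : level b = level c
    · rcases h4.1 e2 with ⟨rfl, rfl⟩ | ⟨rfl, rfl⟩
      · obtain rfl : a = 0 := by omega
        simp [l1, l2, l0]
      · by_cases a0 : a = 0
        · subst a0; simp [l0, l3, l4]; omega
        have : level a = 1 := by
          unfold level; split_ifs <;> omega
        simp [l3, l4, this]; omega
    · split_ifs <;> omega

theorem card_distTriangles_levelDist {n : ℕ} (hn : 6 ≤ n) :
    (distTriangles n levelDist).card = 2 * n - 10 := by
  rw [distTriangles_levelDist (by omega), Finset.card_union_of_disjoint,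
    Finset.card_union_of_disjoint, Finset.card_image_of_injective, Finset.card_image_of_injective,
    Nat.card_Ico, Nat.card_Ico, Finset.card_singleton]
  · omega
  · intro a b hab; simpa using hab
  · intro a b hab; simpa using hab
  · rw [Finset.disjoint_left]
    rintro ⟨a, b, c⟩ h1 h2
    simp only [Finset.mem_image, Prod.mk.injEq] at h1 h2
    omega
  · simp

/-- The function whose values are the entries of a table. -/
def tableDist (l : List (List ℕ)) (a b : ℕ) : ℕ := (l.getD a []).getD b 0

theorem existsAlmostMetrizable_four : ExistsAlmostMetrizable.{u} 4 3 :=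
  IsDist.existsAlmostMetrizable (d := tableDist
    [[0, 2, 2, 3], [2, 0, 2, 1], [2, 2, 0, 2], [3, 1, 2, 0]])
    ⟨by decide +kernel, by decide +kernel, by decide +kernel⟩ (by decide)

theorem existsAlmostMetrizable_five : ExistsAlmostMetrizable.{u} 5 4 :=
  IsDist.existsAlmostMetrizable (d := tableDist
    [[0, 2, 1, 3, 3], [2, 0, 1, 2, 1], [1, 1, 0, 2, 2], [3, 2, 2, 0, 1], [3, 1, 2, 1, 0]])
    ⟨by decide +kernel, by decide +kernel, by decide +kernel⟩ (by decide)

theorem existsAlmostMetrizable_six : ExistsAlmostMetrizable.{u} 6 5 :=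
  IsDist.existsAlmostMetrizable (d := tableDist
    [[0, 1, 2, 3, 5, 4], [1, 0, 1, 2, 4, 3], [2, 1, 0, 1, 3, 4], [3, 2, 1, 0, 2, 5],
      [5, 4, 3, 2, 0, 3], [4, 3, 4, 5, 3, 0]])
    ⟨by decide +kernel, by decide +kernel, by decide +kernel⟩ (by decide)

/-- The metric is that of a hexagon 0, …, 5 with a pendant vertex 6 attached to 4. -/
theorem existsAlmostMetrizable_seven : ExistsAlmostMetrizable.{u} 7 6 :=
  IsDist.existsAlmostMetrizable (d := tableDist
    [[0, 1, 2, 3, 2, 1, 3], [1, 0, 1, 2, 3, 2, 4], [2, 1, 0, 1, 2, 3, 3], [3, 2, 1, 0, 1, 2, 2],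
      [2, 3, 2, 1, 0, 1, 1], [1, 2, 3, 2, 1, 0, 2], [3, 4, 3, 2, 1, 2, 0]])
    ⟨by decide +kernel, by decide +kernel, by decide +kernel⟩ (by decide)

/-- The points 1, 2, 3, 0, 5, 6, 7 lie on a line at positions 0, 3, 5, 6, 7, 9, 10; every triangle
contains the remaining point 4. -/
theorem existsAlmostMetrizable_eight : ExistsAlmostMetrizable.{u} 8 7 :=
  IsDist.existsAlmostMetrizable (d := tableDist
    [[0, 6, 3, 1, 4, 1, 3, 4], [6, 0, 3, 5, 8, 7, 9, 10], [3, 3, 0, 2, 5, 4, 6, 7],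
      [1, 5, 2, 0, 3, 2, 4, 5], [4, 8, 5, 3, 0, 3, 1, 2], [1, 7, 4, 2, 3, 0, 2, 3],
      [3, 9, 6, 4, 1, 2, 0, 1], [4, 10, 7, 5, 2, 3, 1, 0]])
    ⟨by decide +kernel, by decide +kernel, by decide +kernel⟩ (by decide)

end BetweennessStructure

theorem theorem5 :
    (∀ n : ℕ, 9 ≤ n → IsTau.{u} n (n - 2) (2 * n - 10)) ∧
    (∀ n : ℕ, 4 ≤ n → n ≤ 8 → IsTau.{u} n (n - 2) (n - 1)) := by
  constructor
  · intro n hn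
    -- The inequality n - 2 < 2n - 10 is exactly n ≥ 9.
    refine ⟨⟨by omega, ?_⟩, ?_⟩
    · rw [← BetweennessStructure.card_distTriangles_levelDist (by omega)]
      exact (BetweennessStructure.isDist_levelDist n).existsAlmostMetrizable (by omega)
    · rintro m ⟨hm, X, _, _, B, hB, rfl, rfl⟩
      exact hB.coSize_gap hm
  · intro n h4 h8
    refine ⟨⟨by omega, ?_⟩, ?_⟩
    · interval_cases n
      · exact BetweennessStructure.existsAlmostMetrizable_four
      · exact BetweennessStructure.existsAlmostMetrizable_five
      · exact BetweennessStructure.existsAlmostMetrizable_six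
      · exact BetweennessStructure.existsAlmostMetrizable_seven
      · exact BetweennessStructure.existsAlmostMetrizable_eight
    · rintro m ⟨hm, -⟩
      omega
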